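/- Let $R$ be a (not necessarily commutative) ring with $1$ that is local, i.e. has a unique maximal left ideal $\mathfrak m$. (This $\mathfrak m$ is then a two-sided ideal and also the unique maximal right ideal.) Modules are left modules. Suppose that at least one of the following holds: (a) the category of projective $R$-modules can be given the structure of a triangulated category (with the octahedral axiom) whose translation functor $\Sigma$ is the identity functor; (b) $R$ is left noetherian or right noetherian, and the category of finitely generated projective $R$-modules can be given the structure of a triangulated category (with the octahedral axiom) whose translation functor $\Sigma$ is the identity functor. Then: (i) $\mathfrak m^2=\{0\}$; (ii) $\mathfrak m=Rx=xR$ for every $x\in\mathfrak m\setminus\{0\}$. -/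

import Mathlib

open CategoryTheory CategoryTheory.Limits

universe u v

/-- The shift by `ℤ` on a category `C` in which every shift functor, in particular the translation
functor `Σ = shiftFunctor C 1`, is the identity functor (with identity coherence maps). -/
@[reducible]
def identityShift (C : Type u) [Category.{v} C] : HasShift C ℤ :=
  hasShiftMk C ℤ
    { F := fun _ => 𝟭 C
      zero := Iso.refl _
      add := fun _ _ => (Functor.leftUnitor (𝟭 C)).symm }

theorem identityShift_shiftFunctor (C : Type u) [Category.{v} C] (n : ℤ) :
    @shiftFunctor C ℤ _ _ (identityShift C) n = 𝟭 C := rfl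

theorem identityShift_additive (C : Type u) [Category.{v} C] [Preadditive C] (n : ℤ) :
    (@shiftFunctor C ℤ _ _ (identityShift C) n).Additive :=
  inferInstanceAs (𝟭 C).Additive

/-- `C` admits a triangulation whose translation functor is the identity: there is a class of
distinguished triangles `X ⟶ Y ⟶ Z ⟶ X` which makes `C` a triangulated category
(octahedral axiom included) with `Σ = Id`. -/
def AdmitsTriangulationWithIdentityShift (C : Type u) [Category.{v} C] [Preadditive C]
    [HasZeroObject C] : Prop :=
  letI : HasShift C ℤ := identityShift C
  haveI : ∀ n : ℤ, (shiftFunctor C n).Additive := identityShift_additive C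
  ∃ _ : Pretriangulated C, IsTriangulated C

/-- The property of being a projective left `R`-module. -/
def isProjectiveModule (R : Type u) [Ring R] : ObjectProperty (ModuleCat.{u} R) :=
  fun M => Module.Projective R M

/-- The property of being a finitely generated projective left `R`-module. -/
def isFGProjectiveModule (R : Type u) [Ring R] : ObjectProperty (ModuleCat.{u} R) :=
  fun M => Module.Finite R M ∧ Module.Projective R M

instance isProjectiveModule_containsZero (R : Type u) [Ring R] :
    (isProjectiveModule R).ContainsZero where
  exists_zero := ⟨ModuleCat.of R PUnit.{u + 1}, ModuleCat.isZero_of_subsingleton _,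
    inferInstanceAs (Module.Projective R PUnit.{u + 1})⟩

instance isFGProjectiveModule_containsZero (R : Type u) [Ring R] :
    (isFGProjectiveModule R).ContainsZero where
  exists_zero := ⟨ModuleCat.of R PUnit.{u + 1}, ModuleCat.isZero_of_subsingleton _,
    inferInstanceAs (Module.Finite R PUnit.{u + 1}),
    inferInstanceAs (Module.Projective R PUnit.{u + 1})⟩

/-- The category of projective left `R`-modules and `R`-linear maps. -/
abbrev ProjMod (R : Type u) [Ring R] := (isProjectiveModule R).FullSubcategory

/-- The category of finitely generated projective left `R`-modules and `R`-linear maps. -/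
abbrev FGProjMod (R : Type u) [Ring R] := (isFGProjectiveModule R).FullSubcategory

/-! With `Σ = Id`, completing multiplication by `x` on `R` to a triangle gives a periodic sequence
`R → R → Z → R → R`. Finitely generated projectives over a local ring are free, so once `Z` is
finitely generated it is some `Rⁿ`, and the triangle becomes a matrix sequence exact on rows and on
columns (`HasCyclicMatrixCones`). Assume `R` left noetherian. Column exactness makes `xR` the right
annihilator of the left annihilator of `x`; with the chain condition this forces `m` to be nilpotent
and `R` to be artinian. Now take `x ≠ 0` with `m x = 0`. If `m` has length `a`, then `R` has length
`a + 1`, and counting lengths around the sequence gives `n (a + 1) = 2a`, so `a ≤ 1`. Thus `m` is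
zero or simple as a left ideal, and both claims follow. The matrix condition is left-right
symmetric, so the right noetherian case follows by passing to `Rᵐᵒᵖ`. When all projectives are
triangulated, the noetherian property is itself deduced, from cones of maps out of large free
modules. -/

/-! ### Exact sequences from triangles. -/

/-- In a category triangulated with identity shift, every morphism `f : X ⟶ Y` fits into a cyclic
sequence `X ⟶ Y ⟶ Z ⟶ X` which is exact for the represented and corepresented functors. -/
theorem AdmitsTriangulationWithIdentityShift.exists_cone {C : Type u} [Category.{v} C]
    [Preadditive C] [HasZeroObject C] (hC : AdmitsTriangulationWithIdentityShift C)
    {X Y : C} (f : X ⟶ Y) :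
    ∃ (Z : C) (g : Y ⟶ Z) (h : Z ⟶ X), f ≫ g = 0 ∧ g ≫ h = 0 ∧ h ≫ f = 0 ∧
      (∀ (W : C) (a : W ⟶ Y), a ≫ g = 0 → ∃ b, a = b ≫ f) ∧
      (∀ (W : C) (a : W ⟶ Z), a ≫ h = 0 → ∃ b, a = b ≫ g) ∧
      (∀ (W : C) (a : W ⟶ X), a ≫ f = 0 → ∃ b, a = b ≫ h) ∧
      (∀ (W : C) (a : Y ⟶ W), f ≫ a = 0 → ∃ b, a = g ≫ b) ∧
      (∀ (W : C) (a : Z ⟶ W), g ≫ a = 0 → ∃ b, a = h ≫ b) ∧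
      (∀ (W : C) (a : X ⟶ W), h ≫ a = 0 → ∃ b, a = f ≫ b) := by
  let _ : HasShift C ℤ := identityShift C
  have _ : ∀ n : ℤ, (shiftFunctor C n).Additive := identityShift_additive C
  obtain ⟨_, _⟩ := hC
  obtain ⟨Z, g, h, hT⟩ := Pretriangulated.distinguished_cocone_triangle f
  refine ⟨Z, g, h, Pretriangulated.comp_distTriang_mor_zero₁₂ _ hT,
    Pretriangulated.comp_distTriang_mor_zero₂₃ _ hT,
    Pretriangulated.comp_distTriang_mor_zero₃₁ _ hT,
    fun W a ha => Pretriangulated.Triangle.coyoneda_exact₂ _ hT a ha,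
    fun W a ha => Pretriangulated.Triangle.coyoneda_exact₃ _ hT a ha,
    fun W a ha => Pretriangulated.Triangle.coyoneda_exact₁ _ hT a ha,
    fun W a ha => Pretriangulated.Triangle.yoneda_exact₂ _ hT a ha,
    fun W a ha => Pretriangulated.Triangle.yoneda_exact₃ _ hT a ha, fun W a ha => ?_⟩
  -- Rotating the triangle introduces the sign, which is then absorbed into `b`.
  obtain ⟨b, hb⟩ : ∃ b : Y ⟶ W, a = (-f) ≫ b :=
    Pretriangulated.Triangle.yoneda_exact₃ _ (Pretriangulated.rot_of_distTriang _ hT) a ha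
  exact ⟨-b, by rw [hb, Preadditive.neg_comp, Preadditive.comp_neg]⟩

/-- The module-theoretic form of `AdmitsTriangulationWithIdentityShift.exists_cone` for a full
subcategory of modules containing the free module of rank one. -/
theorem AdmitsTriangulationWithIdentityShift.exists_linearMap_cone {R : Type u} [Ring R]
    {Q : ObjectProperty (ModuleCat.{u} R)} [Q.ContainsZero]
    (hQ : AdmitsTriangulationWithIdentityShift Q.FullSubcategory) (hR : Q (ModuleCat.of R R))
    {X Y : ModuleCat.{u} R} (hX : Q X) (hY : Q Y) (f : X →ₗ[R] Y) :
    ∃ (Z : ModuleCat.{u} R) (g : Y →ₗ[R] Z) (h : Z →ₗ[R] X), Q Z ∧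
      Function.Exact f g ∧ Function.Exact g h ∧ Function.Exact h f ∧
      (∀ W : ModuleCat.{u} R, Q W → ∀ a : Y →ₗ[R] W, a ∘ₗ f = 0 → ∃ b, a = b ∘ₗ g) ∧
      (∀ W : ModuleCat.{u} R, Q W → ∀ a : Z →ₗ[R] W, a ∘ₗ g = 0 → ∃ b, a = b ∘ₗ h) ∧
      (∀ W : ModuleCat.{u} R, Q W → ∀ a : X →ₗ[R] W, a ∘ₗ h = 0 → ∃ b, a = b ∘ₗ f) := by
  obtain ⟨Z, g, h, hfg, hgh, hhf, c₁, c₂, c₃, d₁, d₂, d₃⟩ := hQ.exists_cone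
    (X := ⟨X, hX⟩) (Y := ⟨Y, hY⟩) (ObjectProperty.homMk (ModuleCat.ofHom f))
  have comp_zero {A B D : Q.FullSubcategory} {p : A ⟶ B} {q : B ⟶ D} (hpq : p ≫ q = 0)
      (y : A.obj) : q.hom.hom (p.hom.hom y) = 0 :=
    congrArg (fun k : A ⟶ D => k.hom.hom y) hpq
  have exact {A B D : Q.FullSubcategory} {p : A ⟶ B} {q : B ⟶ D} (hpq : p ≫ q = 0)
      (H : ∀ (W : Q.FullSubcategory) (a : W ⟶ B), a ≫ q = 0 → ∃ b, a = b ≫ p) :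
      Function.Exact p.hom.hom q.hom.hom := by
    intro y
    constructor
    · intro hy
      obtain ⟨b, hb⟩ := H ⟨ModuleCat.of R R, hR⟩
        (ObjectProperty.homMk (ModuleCat.ofHom (LinearMap.toSpanSingleton R B.obj y))) (by
          ext
          change q.hom.hom ((1 : R) • y) = 0
          rw [one_smul, hy])
      refine ⟨b.hom.hom (1 : R), ?_⟩
      have := congrArg (fun k : (⟨ModuleCat.of R R, hR⟩ : Q.FullSubcategory) ⟶ B =>
        k.hom.hom (1 : R)) hb
      exact this.symm.trans (one_smul R y)
    · rintro ⟨z, rfl⟩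
      exact comp_zero hpq z
  have dual {A B D : Q.FullSubcategory} {p : A ⟶ B} {q : B ⟶ D}
      (H : ∀ (W : Q.FullSubcategory) (a : B ⟶ W), p ≫ a = 0 → ∃ b, a = q ≫ b)
      (W : ModuleCat.{u} R) (hW : Q W) (a : B.obj →ₗ[R] W) (ha : a ∘ₗ p.hom.hom = 0) :
      ∃ b, a = b ∘ₗ q.hom.hom := by
    obtain ⟨b, hb⟩ := H ⟨W, hW⟩ (ObjectProperty.homMk (ModuleCat.ofHom a)) (by
      ext x
      exact LinearMap.congr_fun ha x)
    exact ⟨b.hom.hom, congrArg (fun k : B ⟶ ⟨W, hW⟩ => k.hom.hom) hb⟩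
  exact ⟨Z.obj, g.hom.hom, h.hom.hom, Z.property, exact hfg c₁, exact hgh c₂, exact hhf c₃,
    dual d₁, dual d₂, dual d₃⟩

/-! ### Noncommutative local rings and their finitely generated projectives. -/

section LocalRing

variable {R : Type u} [Ring R] {m : Ideal R}

/-- `m` is the Jacobson radical, hence two-sided. An `x ∉ m` has a left inverse `z`; since `z * x =
1`, also `z ∉ m`, so `z` has a left inverse too, which must be `x`. -/
theorem mem_iff_not_isUnit_of_unique_isMaximal (hm : m.IsMaximal)
    (hlocal : ∀ I : Ideal R, I.IsMaximal → I = m) (x : R) : x ∈ m ↔ ¬IsUnit x := by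
  have hmJ : m = Ring.jacobson R := by
    rw [Ring.jacobson_eq_sInf_isMaximal]
    exact le_antisymm (le_sInf fun I hI => (hlocal I hI).ge) (sInf_le hm)
  have left_inv (y : R) (hy : y ∉ m) : ∃ z, z * y = 1 := by
    by_contra h
    have hne : Ideal.span {y} ≠ ⊤ := fun htop =>
      h (Ideal.mem_span_singleton'.1 ((Ideal.eq_top_iff_one _).1 htop))
    obtain ⟨M, hM, hle⟩ := Ideal.exists_le_maximal _ hne
    exact hy (hlocal M hM ▸ hle (Ideal.mem_span_singleton_self y))
  constructor
  · exact fun hx hu => hm.ne_top (Ideal.eq_top_of_isUnit_mem _ hx hu)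
  · intro hu
    by_contra hx
    obtain ⟨z, hz⟩ := left_inv x hx
    have hzm : z ∉ m := fun hzm => hm.ne_top <| (Ideal.eq_top_iff_one _).2 <| by
      subst hmJ
      exact hz ▸ Ideal.mul_mem_right x _ hzm
    obtain ⟨w, hw⟩ := left_inv z hzm
    have : w = x := by rw [← mul_one w, ← hz, ← mul_assoc, hw, one_mul]
    subst this
    exact hu ⟨⟨w, z, hw, hz⟩, rfl⟩

variable (hm : ∀ x, x ∈ m ↔ ¬IsUnit x)
include hm

theorem ne_top_of_mem_iff_not_isUnit : m ≠ ⊤ := fun h =>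
  (hm 1).1 (h ▸ Submodule.mem_top) isUnit_one

theorem le_of_mem_iff_not_isUnit {I : Ideal R} (hI : I ≠ ⊤) : I ≤ m := fun x hx =>
  (hm x).2 fun hu => hI (Ideal.eq_top_of_isUnit_mem _ hx hu)

theorem isMaximal_of_mem_iff_not_isUnit : m.IsMaximal :=
  Ideal.isMaximal_def.2 ⟨ne_top_of_mem_iff_not_isUnit hm, fun _ hI => by_contra fun h =>
    hI.not_ge (le_of_mem_iff_not_isUnit hm h)⟩

theorem eq_jacobson_of_mem_iff_not_isUnit : m = Ring.jacobson R := by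
  rw [Ring.jacobson_eq_sInf_isMaximal]
  exact le_antisymm
    (le_sInf fun I hI => ((hI.eq_of_le (ne_top_of_mem_iff_not_isUnit hm)
      (le_of_mem_iff_not_isUnit hm hI.ne_top))).ge)
    (sInf_le (isMaximal_of_mem_iff_not_isUnit hm))

theorem isTwoSided_of_mem_iff_not_isUnit : m.IsTwoSided := by
  rw [eq_jacobson_of_mem_iff_not_isUnit hm]
  infer_instance

/-- A finitely generated projective module over a (noncommutative) local ring is free. -/
theorem exists_linearEquiv_pi_of_projective (P : Type*) [AddCommGroup P] [Module R P]
    [Module.Finite R P] [Module.Projective R P] : ∃ n : ℕ, Nonempty (P ≃ₗ[R] (Fin n → R)) := by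
  classical
  have hex : ∃ n : ℕ, ∃ p : (Fin n → R) →ₗ[R] P, Function.Surjective p :=
    Module.Finite.exists_fin' R P
  obtain ⟨p, hp⟩ := Nat.find_spec hex
  have hmin (k : ℕ) (q : (Fin k → R) →ₗ[R] P) (hq : Function.Surjective q) :
      Nat.find hex ≤ k := Nat.find_min' hex ⟨q, hq⟩
  generalize Nat.find hex = n at p hp hmin
  -- By minimality of `n`: a relation with a unit coefficient would make the `i`-th generator
  -- redundant.
  have entries (v : Fin n → R) (hv : p v = 0) (i : Fin n) : v i ∈ m := by
    rw [hm]
    rintro ⟨u, hu⟩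
    cases n with
    | zero => exact i.elim0
    | succ k =>
      have hsurj : Function.Surjective
          (p ∘ₗ Function.ExtendByZero.linearMap R i.succAbove) := by
        intro y
        obtain ⟨w, rfl⟩ := hp y
        set w' := w - (w i * ↑u⁻¹) • v with hw'
        refine ⟨w' ∘ i.succAbove, ?_⟩
        have : Function.ExtendByZero.linearMap R i.succAbove (w' ∘ i.succAbove) = w' := by
          funext l
          refine Fin.succAboveCases i ?_ (fun l => ?_) l
          · have h0 : w' i = 0 := by simp [hw', ← hu]
            rw [h0]
            exact Function.extend_apply' _ _ _ fun ⟨l, hl⟩ => Fin.succAbove_ne i l hl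
          · exact i.succAbove_right_injective.extend_apply _ _ _
        rw [LinearMap.comp_apply, this, hw', map_sub, map_smul, hv, smul_zero, sub_zero]
      have := hmin k _ hsurj
      omega
  obtain ⟨s, hs⟩ := Module.projective_lifting_property p LinearMap.id hp
  have hs' (y : P) : p (s y) = y := LinearMap.congr_fun hs y
  let e : (Fin n → R) →ₗ[R] (Fin n → R) := LinearMap.id - s ∘ₗ p
  have hfg : (LinearMap.ker p).FG := by
    have : LinearMap.ker p = LinearMap.range e := by
      ext v
      constructor
      · intro hv
        exact ⟨v, by simp [e, LinearMap.mem_ker.1 hv]⟩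
      · rintro ⟨w, rfl⟩
        simp [e, hs']
    rw [this]
    exact Submodule.FG.of_finite
  -- Nakayama: `e` projects onto the kernel, so `v = e v = ∑ v i • e (eᵢ)` with every `v i ∈ m` puts
  -- the kernel inside `m` times itself.
  have hbot : LinearMap.ker p = ⊥ := by
    refine hfg.eq_bot_of_le_jacobson_smul fun v hv => ?_
    rw [← eq_jacobson_of_mem_iff_not_isUnit hm]
    have hev : v = e v := by simp [e, LinearMap.mem_ker.1 hv]
    rw [hev, pi_eq_sum_univ' v, map_sum]
    refine Submodule.sum_mem _ fun i _ => ?_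
    rw [map_smul]
    exact Submodule.smul_mem_smul (entries v hv i) (by simp [e, hs'])
  exact ⟨n, ⟨(LinearEquiv.ofBijective p ⟨LinearMap.ker_eq_bot.1 hbot, hp⟩).symm⟩⟩

end LocalRing

/-! ### Cyclic matrix sequences and their left-right symmetry. -/

/-- Every element `x` of `R` fits into a three-periodic sequence `R → Rⁿ → R → R` of matrices, the
last map being multiplication by `x`, which is exact on row vectors and on column vectors. -/
def HasCyclicMatrixCones (R : Type u) [Ring R] : Prop :=
  ∀ x : R, ∃ (n : ℕ) (g h : Fin n → R),
    ((∀ r, (∀ i, r * g i = 0) ↔ ∃ s, r = s * x) ∧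
      (∀ v : Fin n → R, ∑ i, v i * h i = 0 ↔ ∃ s, ∀ i, v i = s * g i) ∧
      (∀ r, r * x = 0 ↔ ∃ v : Fin n → R, r = ∑ i, v i * h i)) ∧
    ((∀ r, (∀ i, h i * r = 0) ↔ ∃ s, r = x * s) ∧
      (∀ v : Fin n → R, ∑ i, g i * v i = 0 ↔ ∃ s, ∀ i, v i = h i * s) ∧
      (∀ r, x * r = 0 ↔ ∃ v : Fin n → R, r = ∑ i, g i * v i))

open MulOpposite in
-- Transposition swaps `g` with `h` and row exactness with column exactness.
theorem HasCyclicMatrixCones.op {R : Type u} [Ring R] (hR : HasCyclicMatrixCones R) :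
    HasCyclicMatrixCones Rᵐᵒᵖ := by
  intro x
  obtain ⟨n, g, h, ⟨l₁, l₂, l₃⟩, r₁, r₂, r₃⟩ := hR x.unop
  refine ⟨n, fun i => MulOpposite.op (h i), fun i => MulOpposite.op (g i), ⟨?_, ?_, ?_⟩, ?_, ?_, ?_⟩
  · intro r
    simpa [← unop_inj, MulOpposite.exists] using r₁ r.unop
  · intro v
    simpa [← unop_inj, MulOpposite.exists] using r₂ fun i => (v i).unop
  · intro r
    have := r₃ r.unop
    rw [← unop_inj, unop_mul, MulOpposite.unop_zero, this]
    constructor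
    · rintro ⟨v, hv⟩
      exact ⟨fun i => MulOpposite.op (v i), by simp [← unop_inj, hv]⟩
    · rintro ⟨v, hv⟩
      exact ⟨fun i => (v i).unop, by simp [hv]⟩
  · intro r
    simpa [← unop_inj, MulOpposite.exists] using l₁ r.unop
  · intro v
    simpa [← unop_inj, MulOpposite.exists] using l₂ fun i => (v i).unop
  · intro r
    have := l₃ r.unop
    rw [← unop_inj, unop_mul, MulOpposite.unop_zero, this]
    constructor
    · rintro ⟨v, hv⟩
      exact ⟨fun i => MulOpposite.op (v i), by simp [← unop_inj, hv]⟩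
    · rintro ⟨v, hv⟩
      exact ⟨fun i => (v i).unop, by simp [hv]⟩

/-! ### The ring-theoretic conclusion under a one-sided noetherian hypothesis. -/

section LeftNoetherian

variable {R : Type u} [Ring R] {m : Ideal R}

/-- Principal right ideals are right annihilators. -/
theorem HasCyclicMatrixCones.exists_eq_mul (hR : HasCyclicMatrixCones R) {a y : R}
    (hay : ∀ r, r * a = 0 → r * y = 0) : ∃ s, y = a * s := by
  obtain ⟨n, g, h, ⟨-, -, l₃⟩, r₁, -, -⟩ := hR a
  -- Each `h i` kills `a` on the left, hence kills `y`; column exactness then gives `y ∈ aR`.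
  refine (r₁ y).1 fun i => hay _ ((l₃ _).2 ⟨Pi.single i 1, ?_⟩)
  simp [Pi.single_apply]

/-- The left annihilator of an element, as a left ideal. -/
abbrev leftAnnihilator (a : R) : Ideal R := LinearMap.ker (LinearMap.toSpanSingleton R R a)

theorem mem_leftAnnihilator {a r : R} : r ∈ leftAnnihilator a ↔ r * a = 0 := Iff.rfl

variable (hm : ∀ x, x ∈ m ↔ ¬IsUnit x)
include hm

/-- Right `T`-nilpotency: a sequence of right multiples by elements of the maximal ideal vanishes
eventually. -/
theorem exists_eq_zero_of_succ_eq_mul [IsNoetherianRing R] (hR : HasCyclicMatrixCones R)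
    (b : ℕ → R) (hb : ∀ n, ∃ z ∈ m, b (n + 1) = b n * z) : ∃ n, b n = 0 := by
  have hmono : Monotone fun n => leftAnnihilator (b n) := monotone_nat_of_le_succ fun n r hr => by
    obtain ⟨z, -, hz⟩ := hb n
    rw [mem_leftAnnihilator] at hr ⊢
    rw [hz, ← mul_assoc, hr, zero_mul]
  obtain ⟨n, hn⟩ := monotone_stabilizes_iff_noetherian.2 ‹IsNoetherianRing R› ⟨_, hmono⟩
  -- Equal left annihilators give `b n = b (n + 1) * s = b n * z * s`, and `1 - z * s` is a unit.
  obtain ⟨s, hs⟩ := hR.exists_eq_mul (a := b (n + 1)) (y := b n) fun r hr => by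
    have hn1 : leftAnnihilator (b n) = leftAnnihilator (b (n + 1)) := hn (n + 1) n.le_succ
    rw [← mem_leftAnnihilator, hn1]
    exact hr
  obtain ⟨z, hz, hbz⟩ := hb n
  have := isTwoSided_of_mem_iff_not_isUnit hm
  have hu : IsUnit (1 - z * s) := by
    by_contra hu
    exact ne_top_of_mem_iff_not_isUnit hm <| (Ideal.eq_top_iff_one _).2 <| by
      simpa using m.add_mem ((hm _).2 hu) (m.mul_mem_right s hz)
  refine ⟨n, hu.mul_left_eq_zero.1 ?_⟩
  rw [mul_sub, mul_one, sub_eq_zero, ← mul_assoc, ← hbz, ← hs]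

/-- The left annihilators `A k` of `m ^ k` stabilise at some `n`. If `m ^ n ≠ 0`, then `1 ∉ A n`,
and any element outside `A n` stays outside after right multiplication by a suitable element of `m`;
iterating contradicts `T`-nilpotency. -/
theorem exists_pow_eq_bot_of_isNoetherianRing [IsNoetherianRing R] (hR : HasCyclicMatrixCones R) :
    ∃ n : ℕ, m ^ n = ⊥ := by
  have := isTwoSided_of_mem_iff_not_isUnit hm
  let A (k : ℕ) : Ideal R :=
    { carrier := {r | ∀ y ∈ m ^ k, r * y = 0}
      add_mem' := fun ha hb y hy => by rw [add_mul, ha y hy, hb y hy, add_zero]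
      zero_mem' := fun y _ => zero_mul y
      smul_mem' := fun c x hx y hy => by rw [smul_eq_mul, mul_assoc, hx y hy, mul_zero] }
  have hA : Monotone A := fun k l hkl r hr y hy => hr y (Ideal.pow_le_pow_right hkl hy)
  obtain ⟨n, hn⟩ := monotone_stabilizes_iff_noetherian.2 ‹IsNoetherianRing R› ⟨A, hA⟩
  have step (r : R) (hr : r ∉ A n) : ∃ z ∈ m, r * z ∉ A n := by
    by_contra! h
    refine hr ?_
    have hn1 : A n = A (n + 1) := hn (n + 1) n.le_succ
    rw [hn1]
    intro y hy
    rw [Ideal.IsTwoSided.pow_succ] at hy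
    refine Submodule.mul_induction_on hy (fun z hz w hw => ?_) fun a b ha hb => ?_
    · rw [← mul_assoc]
      exact h z hz w hw
    · rw [mul_add, ha, hb, add_zero]
  refine ⟨n, ?_⟩
  by_contra hne
  have h1 : (1 : R) ∉ A n := fun h1 => hne <| (Submodule.eq_bot_iff _).2 fun y hy => by
    simpa using h1 y hy
  choose! z hz hz' using step
  let b : ℕ → {r // r ∉ A n} := fun k =>
    k.rec ⟨1, h1⟩ fun _ r => ⟨r.1 * z r.1, hz' r.1 r.2⟩
  obtain ⟨k, hk⟩ := exists_eq_zero_of_succ_eq_mul hm hR (fun k => (b k).1)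
    fun k => ⟨z (b k).1, hz _ (b k).2, rfl⟩
  exact (b k).2 (hk ▸ (A n).zero_mem)

/-- Hopkins–Levitzki: `m` is nilpotent and `R ⧸ m` is a division ring, so `R` is semiprimary. -/
theorem isArtinianRing_of_isNoetherianRing [IsNoetherianRing R] (hR : HasCyclicMatrixCones R) :
    IsArtinianRing R := by
  obtain ⟨n, hn⟩ := exists_pow_eq_bot_of_isNoetherianRing hm hR
  have hJ := eq_jacobson_of_mem_iff_not_isUnit hm
  have : IsSemiprimaryRing R :=
    { isSemisimpleRing := by
        have htop := ne_top_of_mem_iff_not_isUnit hm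
        rw [hJ] at htop hm
        have : IsSimpleModule (R ⧸ Ring.jacobson R) (R ⧸ Ring.jacobson R) := by
          refine isSimpleModule_self_iff_isUnit.2 ⟨Ideal.Quotient.nontrivial_iff.2 htop, ?_⟩
          intro x hx
          obtain ⟨r, rfl⟩ := Ideal.Quotient.mk_surjective x
          have hr : IsUnit r := by
            by_contra hr
            exact hx (Ideal.Quotient.eq_zero_iff_mem.2 ((hm r).2 hr))
          exact hr.map _
        infer_instance
      isNilpotent := ⟨n, hJ ▸ hn⟩ }
  exact IsSemiprimaryRing.isNoetherian_iff_isArtinian.1 ‹IsNoetherianRing R›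

theorem length_maximal_le_one_of_isNoetherianRing [IsNoetherianRing R]
    (hR : HasCyclicMatrixCones R) : Module.length R m ≤ 1 := by
  classical
  have := isTwoSided_of_mem_iff_not_isUnit hm
  have htop := ne_top_of_mem_iff_not_isUnit hm
  have : Nontrivial R := nontrivial_of_ne (0 : R) 1 fun h => htop <|
    (Ideal.eq_top_iff_one _).2 (h ▸ m.zero_mem)
  have := isArtinianRing_of_isNoetherianRing hm hR
  -- Any nonzero element of the last nonzero power of `m` works.
  obtain ⟨x, hx0, hmx⟩ : ∃ x : R, x ≠ 0 ∧ ∀ z ∈ m, z * x = 0 := by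
    have hex := exists_pow_eq_bot_of_isNoetherianRing hm hR
    obtain ⟨k, hk⟩ := Nat.exists_eq_succ_of_ne_zero (n := Nat.find hex) fun h0 => by
      have := Nat.find_spec hex
      rw [h0, Submodule.pow_zero, Ideal.one_eq_top] at this
      exact top_ne_bot this
    have hk' : m ^ k ≠ ⊥ := Nat.find_min hex (hk ▸ k.lt_succ_self)
    obtain ⟨x, hx, hx0⟩ := Submodule.exists_mem_ne_zero_of_ne_bot hk'
    refine ⟨x, hx0, fun z hz => ?_⟩
    have hzx : z * x ∈ m ^ (k + 1) := by
      rw [Ideal.IsTwoSided.pow_succ]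
      exact Ideal.mul_mem_mul hz hx
    rw [← Nat.succ_eq_add_one, ← hk, Nat.find_spec hex] at hzx
    exact hzx
  let f : R →ₗ[R] R := LinearMap.toSpanSingleton R R x
  have hkerf : LinearMap.ker f = m := by
    refine le_antisymm (le_of_mem_iff_not_isUnit hm fun h => hx0 ?_) hmx
    have : (1 : R) ∈ LinearMap.ker f := h ▸ Submodule.mem_top
    simpa [f] using this
  obtain ⟨n, g, h, ⟨l₁, l₂, l₃⟩, -⟩ := hR x
  let G : R →ₗ[R] (Fin n → R) := LinearMap.pi fun i => LinearMap.toSpanSingleton R R (g i)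
  let H : (Fin n → R) →ₗ[R] R := Fintype.linearCombination R h
  have hkerG : LinearMap.ker G = LinearMap.range f := by
    ext r
    simpa [G, f, funext_iff, eq_comm] using l₁ r
  have hkerH : LinearMap.ker H = LinearMap.range G := by
    ext v
    simpa [G, H, Fintype.linearCombination_apply, funext_iff, eq_comm] using l₂ v
  have hrangeH : LinearMap.range H = m := by
    rw [← hkerf]
    ext r
    simpa only [f, H, LinearMap.mem_range, LinearMap.mem_ker, Fintype.linearCombination_apply,
      LinearMap.toSpanSingleton_apply, smul_eq_mul, eq_comm] using (l₃ r).symm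
  have rank_nullity {M N : Type u} [AddCommGroup M] [Module R M] [AddCommGroup N] [Module R N]
      (F : M →ₗ[R] N) : Module.length R M =
        Module.length R (LinearMap.ker F) + Module.length R (LinearMap.range F) :=
    Module.length_eq_add_of_exact (LinearMap.ker F).subtype F.rangeRestrict
      (LinearMap.ker F).injective_subtype F.surjective_rangeRestrict
      (LinearMap.exact_iff.2 (by rw [LinearMap.ker_rangeRestrict, Submodule.range_subtype]))
  have hsimple : IsSimpleModule R (R ⧸ m) :=
    isSimpleModule_iff_isCoatom.2 (Ideal.isMaximal_def.1 (isMaximal_of_mem_iff_not_isUnit hm))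
  have e₀ := Module.length_eq_add_of_exact m.subtype m.mkQ m.injective_subtype m.mkQ_surjective
    (LinearMap.exact_subtype_mkQ m)
  rw [Module.length_eq_one R (R ⧸ m)] at e₀
  have e₁ := rank_nullity f
  have e₂ := rank_nullity G
  have e₃ := rank_nullity H
  rw [hkerf] at e₁
  rw [hkerG] at e₂
  rw [hkerH, hrangeH, Module.length_pi, ENat.card_eq_coe_fintype_card, Fintype.card_fin] at e₃
  have hL := Module.length_ne_top (R := R) (M := R)
  generalize Module.length R R = L at *
  generalize Module.length R m = a at *
  generalize Module.length R (LinearMap.range f) = b at *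
  generalize Module.length R (LinearMap.range G) = c at *
  lift L to ℕ using hL
  have ha : a ≠ ⊤ := by rintro rfl; simp at e₀
  have hb : b ≠ ⊤ := by rintro rfl; simp at e₁
  have hc : c ≠ ⊤ := by rintro rfl; simp at e₂
  lift a to ℕ using ha
  lift b to ℕ using hb
  lift c to ℕ using hc
  norm_cast at *
  obtain rfl : b = 1 := by omega
  obtain rfl : c = a := by omega
  subst e₀
  -- What remains is `n * (a + 1) = 2 * a`: `n = 0` gives `a = 0`, `n = 1` gives `a = 1`, and `n ≥
  -- 2` is impossible.
  rcases Nat.lt_or_ge n 2 with hn | hn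
  · interval_cases n <;> omega
  · nlinarith

theorem maximal_mul_eq_zero_and_eq_mul_of_isNoetherianRing [IsNoetherianRing R]
    (hR : HasCyclicMatrixCones R) :
    (∀ x ∈ m, ∀ y ∈ m, x * y = 0) ∧
      ∀ x ∈ m, x ≠ 0 → ∀ y ∈ m, (∃ r, y = r * x) ∧ ∃ r, y = x * r := by
  have hleft (x : R) (hx : x ∈ m) (hx0 : x ≠ 0) (y : R) (hy : y ∈ m) : ∃ r, y = r * x := by
    have hpos : Module.length R m = 1 :=
      le_antisymm (length_maximal_le_one_of_isNoetherianRing hm hR) <| by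
        have : Nontrivial m := ⟨⟨⟨x, hx⟩, 0, fun h => hx0 (congrArg Subtype.val h)⟩⟩
        exact Order.one_le_iff_pos.2 Module.length_pos
    have hatom : IsAtom m := isSimpleModule_iff_isAtom.1 (Module.length_eq_one_iff.1 hpos)
    rcases hatom.le_iff.1 ((Ideal.span_singleton_le_iff_mem m).2 hx) with h | h
    · exact absurd (Ideal.span_singleton_eq_bot.1 h) hx0
    · rw [← h, Ideal.mem_span_singleton'] at hy
      exact hy.imp fun _ => Eq.symm
  have hmul (x : R) (hx : x ∈ m) (y : R) (hy : y ∈ m) : x * y = 0 := by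
    by_contra hxy
    -- If `x * y ≠ 0`, it generates `m`, so `y = r * x * y` with `1 - r * x` a unit, forcing `y =
    -- 0`.
    obtain ⟨r, hr⟩ := hleft (x * y) (m.mul_mem_left x hy) hxy y hy
    have hu : IsUnit (1 - r * x) := by
      by_contra hu
      exact ne_top_of_mem_iff_not_isUnit hm <| (Ideal.eq_top_iff_one _).2 <| by
        simpa using m.add_mem ((hm _).2 hu) (m.mul_mem_left r hx)
    have : (1 - r * x) * y = 0 := by rw [sub_mul, one_mul, mul_assoc, ← hr, sub_self]
    rw [hu.mul_right_eq_zero] at this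
    exact hxy (by rw [this, mul_zero])
  refine ⟨hmul, fun x hx hx0 y hy => ⟨hleft x hx hx0 y hy, hR.exists_eq_mul fun r hr => ?_⟩⟩
  exact hmul r ((hm r).2 fun hu => hx0 (hu.mul_right_eq_zero.1 hr)) y hy

/-- The right noetherian case, obtained by passing to the opposite ring. -/
theorem maximal_mul_eq_zero_and_eq_mul_of_isNoetherianRing_op [IsNoetherianRing Rᵐᵒᵖ]
    (hR : HasCyclicMatrixCones R) :
    (∀ x ∈ m, ∀ y ∈ m, x * y = 0) ∧
      ∀ x ∈ m, x ≠ 0 → ∀ y ∈ m, (∃ r, y = r * x) ∧ ∃ r, y = x * r := by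
  have := isTwoSided_of_mem_iff_not_isUnit hm
  let m' : Ideal Rᵐᵒᵖ :=
    { carrier := {x | x.unop ∈ m}
      add_mem' := fun ha hb => m.add_mem ha hb
      zero_mem' := m.zero_mem
      smul_mem' := fun c x hx => m.mul_mem_right c.unop hx }
  have hm' (x : Rᵐᵒᵖ) : x ∈ m' ↔ ¬IsUnit x :=
    (hm x.unop).trans (not_congr isUnit_unop)
  obtain ⟨hmul, hspan⟩ := maximal_mul_eq_zero_and_eq_mul_of_isNoetherianRing hm' hR.op
  refine ⟨fun x hx y hy => MulOpposite.op_injective (hmul (.op y) hy (.op x) hx),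
    fun x hx hx0 y hy => ?_⟩
  obtain ⟨⟨r, hr⟩, s, hs⟩ :=
    hspan (.op x) hx (fun h => hx0 (MulOpposite.op_injective h)) (.op y) hy
  exact ⟨⟨s.unop, congrArg MulOpposite.unop hs⟩, r.unop, congrArg MulOpposite.unop hr⟩

end LeftNoetherian

/-! ### From triangulations to matrices and chain conditions. -/

/-- In a basis of the cone, exactness of the underlying modules gives the row conditions, and
factorisation of maps into `R` gives the column conditions. -/
theorem hasCyclicMatrixCones_of_admitsTriangulation {R : Type u} [Ring R] {m : Ideal R}
    (hm : ∀ x, x ∈ m ↔ ¬IsUnit x) {Q : ObjectProperty (ModuleCat.{u} R)} [Q.ContainsZero]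
    (hQ : AdmitsTriangulationWithIdentityShift Q.FullSubcategory) (hR : Q (ModuleCat.of R R))
    (hproj : ∀ Z : ModuleCat.{u} R, Q Z → Module.Projective R Z)
    (hfin : ∀ Z : ModuleCat.{u} R, Q Z → ∀ (g : R →ₗ[R] Z) (h : Z →ₗ[R] R),
      Function.Exact g h → Module.Finite R Z) : HasCyclicMatrixCones R := by
  classical
  intro x
  obtain ⟨Z, g, h, hZ, hfg, hgh, hhf, d₁, d₂, d₃⟩ :=
    hQ.exists_linearMap_cone hR hR hR (LinearMap.toSpanSingleton R R x)
  have := hproj Z hZ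
  have := hfin Z hZ g h hgh
  obtain ⟨n, ⟨e⟩⟩ := exists_linearEquiv_pi_of_projective hm Z
  have hg (r : R) (i : Fin n) : e (g r) i = r * e (g 1) i := by
    rw [← smul_eq_mul, ← Pi.smul_apply, ← map_smul, ← map_smul, smul_eq_mul, mul_one]
  have hh (v : Fin n → R) : h (e.symm v) = ∑ i, v i * h (e.symm (Pi.single i 1)) := by
    conv_lhs => rw [pi_eq_sum_univ' v, map_sum, map_sum]
    simp [map_smul]
  refine ⟨n, e (g 1), fun i => h (e.symm (Pi.single i 1)), ⟨fun r => ?_, fun v => ?_, fun r => ?_⟩,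
    fun r => ?_, fun v => ?_, fun r => ?_⟩
  · have : (∀ i, r * e (g 1) i = 0) ↔ g r = 0 := by
      simp_rw [← hg]
      rw [← e.map_eq_zero_iff, funext_iff]
      rfl
    rw [this, hfg r]
    exact exists_congr fun s => eq_comm
  · rw [← hh, hgh]
    refine exists_congr fun s => ?_
    simp_rw [← hg]
    rw [← funext_iff, e.eq_symm_apply, eq_comm]
  · have := hhf r
    rw [LinearMap.toSpanSingleton_apply, smul_eq_mul] at this
    rw [this]
    constructor
    · rintro ⟨z, rfl⟩
      exact ⟨e z, by rw [← hh, e.symm_apply_apply]⟩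
    · rintro ⟨v, rfl⟩
      exact ⟨e.symm v, hh v⟩
  · constructor
    · intro hr
      obtain ⟨b, hb⟩ := d₃ (ModuleCat.of R R) hR (LinearMap.toSpanSingleton R R r) (by
        ext z
        change h z * r = 0
        rw [← e.symm_apply_apply z, hh, Finset.sum_mul]
        exact Finset.sum_eq_zero fun i _ => by rw [mul_assoc, hr, mul_zero])
      refine ⟨b 1, ?_⟩
      have : r = b x := by simpa using LinearMap.congr_fun hb (1 : R)
      rw [this, ← smul_eq_mul, ← map_smul, smul_eq_mul, mul_one]
    · rintro ⟨s, rfl⟩ i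
      rw [← mul_assoc]
      have : h (e.symm (Pi.single i 1)) * x = 0 := hhf.apply_apply_eq_zero _
      rw [this, zero_mul]
  · constructor
    · intro hv
      obtain ⟨b, hb⟩ := d₂ (ModuleCat.of R R) hR (Fintype.linearCombination R v ∘ₗ e) (by
        ext
        simpa [Fintype.linearCombination_apply] using hv)
      refine ⟨b 1, fun i => ?_⟩
      have : v i = b (h (e.symm (Pi.single i 1))) := by
        simpa using LinearMap.congr_fun hb (e.symm (Pi.single i 1))
      rw [this, ← smul_eq_mul, ← map_smul, smul_eq_mul, mul_one]
    · rintro ⟨s, hs⟩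
      simp_rw [hs, ← mul_assoc]
      rw [← Finset.sum_mul, ← hh, e.symm_apply_apply, hgh.apply_apply_eq_zero, zero_mul]
  · constructor
    · intro hr
      obtain ⟨b, hb⟩ := d₁ (ModuleCat.of R R) hR (LinearMap.toSpanSingleton R R r) (by
        ext
        simpa using hr)
      refine ⟨fun i => b (e.symm (Pi.single i 1)), ?_⟩
      have h1 : r = b (g 1) := by simpa using LinearMap.congr_fun hb (1 : R)
      rw [h1, ← e.symm_apply_apply (g 1)]
      conv_lhs => rw [pi_eq_sum_univ' (e (g 1)), map_sum, map_sum]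
      simp [map_smul]
    · rintro ⟨v, rfl⟩
      have : e (g x) = 0 := by
        have hx := hfg.apply_apply_eq_zero (1 : R)
        rw [LinearMap.toSpanSingleton_apply, one_smul] at hx
        rw [hx, map_zero]
      rw [Finset.mul_sum]
      refine Finset.sum_eq_zero fun i _ => ?_
      rw [← mul_assoc, ← hg, this, Pi.zero_apply, zero_mul]

/-- If all projective modules form a triangulated category with identity shift, then countable
free modules have the extension property for left ideals and left ideals are left annihilators,
so the ring is left noetherian. -/
theorem isNoetherianRing_of_admitsTriangulation {R : Type u} [Ring R]
    (hR : AdmitsTriangulationWithIdentityShift (ProjMod R)) : IsNoetherianRing R := by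
  have key (I : Ideal R) : (∀ y ∉ I, ∃ c : R, (∀ a ∈ I, a * c = 0) ∧ y * c ≠ 0) ∧
      ∀ t : I →ₗ[R] (ℕ →₀ R), ∃ w : ℕ →₀ R, ∀ a : I, t a = (a : R) • w := by
    let p : (I →₀ R) →ₗ[R] I := Finsupp.linearCombination R id
    have hp : Function.Surjective p := Finsupp.linearCombination_id_surjective R I
    -- A free module mapping onto `I`: the cone of `f` embeds `R ⧸ I` in a projective, and maps from
    -- `I` to projectives extend to `R`.
    let f : (I →₀ R) →ₗ[R] R := I.subtype ∘ₗ p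
    obtain ⟨Z, g, h, hZ, hfg, -, hhf, -, -, d₃⟩ := hR.exists_linearMap_cone
      (X := ModuleCat.of R (I →₀ R)) (Y := ModuleCat.of R R)
      (inferInstanceAs (Module.Projective R R)) (inferInstanceAs (Module.Projective R (I →₀ R)))
      (inferInstanceAs (Module.Projective R R)) f
    have hgI (a : R) (ha : a ∈ I) : g a = 0 := by
      obtain ⟨z, hz⟩ := hp ⟨a, ha⟩
      exact (hfg a).2 ⟨z, congrArg Subtype.val hz⟩
    constructor
    · intro y hy
      obtain ⟨s, hs⟩ := Module.projective_def'.1 hZ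
      have hgy : s (g y) ≠ 0 := fun h0 => by
        have hy0 : g y = 0 := by
          have := LinearMap.congr_fun hs (g y)
          rw [LinearMap.comp_apply, h0, map_zero] at this
          exact this.symm
        obtain ⟨z, hz⟩ := (hfg y).1 hy0
        exact hy (hz ▸ (p z).2)
      obtain ⟨i, hi⟩ := DFunLike.ne_iff.1 hgy
      have hmul (a : R) : s (g a) i = a * s (g 1) i := by
        rw [← smul_eq_mul, ← Finsupp.smul_apply, ← map_smul, ← map_smul, smul_eq_mul, mul_one]
      exact ⟨s (g 1) i, fun a ha => by rw [← hmul, hgI a ha, map_zero, Finsupp.zero_apply],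
        hmul y ▸ hi⟩
    · intro t
      let W : ModuleCat.{u} R := ModuleCat.of R (ℕ →₀ R)
      obtain ⟨b, hb⟩ := d₃ W (inferInstanceAs (Module.Projective R (ℕ →₀ R))) (t ∘ₗ p) (by
        ext z
        have hz : p (h z) = 0 := Subtype.ext (hhf.apply_apply_eq_zero z)
        exact DFunLike.congr_fun ((congrArg t hz).trans t.map_zero) _)
      refine ⟨b (1 : R), fun a => ?_⟩
      obtain ⟨z, rfl⟩ := hp a
      refine (LinearMap.congr_fun hb z).trans ?_
      change b (p z : R) = _
      rw [← map_smul, smul_eq_mul, mul_one]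
  refine monotone_stabilizes_iff_noetherian.1 fun A => ?_
  by_contra! hA
  have hsup (n : ℕ) : ∃ y ∈ ⨆ k, A k, y ∉ A n := by
    obtain ⟨k, hnk, hne⟩ := hA n
    obtain ⟨y, hy, hyn⟩ := SetLike.exists_of_lt (lt_of_le_of_ne (A.monotone hnk) hne)
    exact ⟨y, le_iSup A k hy, hyn⟩
  choose y hy hyn using hsup
  choose c hc hyc using fun n => (key (A n)).1 (y n) (hyn n)
  have hfinite (a : ↥(⨆ k, A k)) : (Function.support fun n => (a : R) * c n).Finite := by
    obtain ⟨k, hk⟩ := (Submodule.mem_iSup_of_directed A A.monotone.directed_le).1 a.2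
    refine (Set.finite_lt_nat k).subset fun n hn => ?_
    by_contra hkn
    exact hn (hc n a (A.monotone (not_lt.1 hkn) hk))
  -- Each `a` in the union lies in some `A k` and is killed by `c n` for `n ≥ k`, so `(a * c n)ₙ`
  -- has finite support. But `t` is right multiplication by a single finitely supported `w`,
  -- contradicting `y n * c n ≠ 0` for all `n`.
  let t : ↥(⨆ k, A k) →ₗ[R] (ℕ →₀ R) :=
    { toFun := fun a => Finsupp.ofSupportFinite _ (hfinite a)
      map_add' := fun a b => Finsupp.ext fun n => add_mul (a : R) b (c n)
      map_smul' := fun r a => Finsupp.ext fun n => mul_assoc r (a : R) (c n) }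
  obtain ⟨w, hw⟩ := (key (⨆ k, A k)).2 t
  obtain ⟨n, hn⟩ := Infinite.exists_notMem_finset w.support
  refine hyc n ?_
  have := DFunLike.congr_fun (hw ⟨y n, hy n⟩) n
  rw [Finsupp.smul_apply, Finsupp.notMem_support_iff.1 hn, smul_zero] at this
  exact this

theorem mainTheorem2 (R : Type u) [Ring R] (m : Ideal R) (hm : m.IsMaximal)
    (hlocal : ∀ I : Ideal R, I.IsMaximal → I = m)
    (htri : AdmitsTriangulationWithIdentityShift (ProjMod R) ∨
      ((IsNoetherianRing R ∨ IsNoetherianRing Rᵐᵒᵖ) ∧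
        AdmitsTriangulationWithIdentityShift (FGProjMod R))) :
    m * m = ⊥ ∧
      ∀ x ∈ m, x ≠ 0 →
        (m : Set R) = {y | ∃ r : R, y = r * x} ∧ (m : Set R) = {y | ∃ r : R, y = x * r} := by
  have hu := mem_iff_not_isUnit_of_unique_isMaximal hm hlocal
  have htwo := isTwoSided_of_mem_iff_not_isUnit hu
  have main : (∀ x ∈ m, ∀ y ∈ m, x * y = 0) ∧
      ∀ x ∈ m, x ≠ 0 → ∀ y ∈ m, (∃ r, y = r * x) ∧ ∃ r, y = x * r := by
    rcases htri with h | ⟨hN, h⟩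
    · have hN := isNoetherianRing_of_admitsTriangulation h
      refine maximal_mul_eq_zero_and_eq_mul_of_isNoetherianRing hu <|
        hasCyclicMatrixCones_of_admitsTriangulation hu h
          (inferInstanceAs (Module.Projective R R)) (fun _ hZ => hZ) fun Z _ g k hgk => ?_
      -- The cone is an extension of a left ideal by a quotient of `R`, so it is noetherian.
      have := isNoetherian_of_range_eq_ker g k hgk.linearMap_ker_eq.symm
      infer_instance
    · have hcone : HasCyclicMatrixCones R := hasCyclicMatrixCones_of_admitsTriangulation hu h
        ⟨inferInstanceAs (Module.Finite R R), inferInstanceAs (Module.Projective R R)⟩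
        (fun _ hZ => hZ.2) fun _ hZ _ _ _ => hZ.1
      rcases hN with hN | hN
      · exact maximal_mul_eq_zero_and_eq_mul_of_isNoetherianRing hu hcone
      · exact maximal_mul_eq_zero_and_eq_mul_of_isNoetherianRing_op hu hcone
  refine ⟨le_bot_iff.1 (Ideal.mul_le.2 fun x hx y hy => main.1 x hx y hy), fun x hx hx0 => ⟨?_, ?_⟩⟩
  · ext y
    refine ⟨fun hy => (main.2 x hx hx0 y hy).1, ?_⟩
    rintro ⟨r, rfl⟩
    exact m.mul_mem_left r hx
  · ext y
    refine ⟨fun hy => (main.2 x hx hx0 y hy).2, ?_⟩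
    rintro ⟨r, rfl⟩
    exact m.mul_mem_right r hx
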